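/- Let $\mathbb{N}=\{1,2,3,\dots\}$. A set $B\subseteq\mathbb{N}$ is an $IP$-set if there is a sequence $(x_t)_{t\ge 1}$ in $\mathbb{N}$ with $\sum_{t\in H}x_t\in B$ for every nonempty finite $H\subseteq\mathbb{N}$; a set $A\subseteq\mathbb{N}$ is an $IP^{\star}$-set if it meets every $IP$-set. A measure preserving system $(X,\mathcal{B},\mu,T)$ consists of a probability space $(X,\mathcal{B},\mu)$ and a measurable map $T:X\to X$ (not necessarily invertible) with $\mu(T^{-1}B)=\mu(B)$ for all $B\in\mathcal{B}$. It is called mild mixing if for all $\varepsilon>0$ and all $A,B\in\mathcal{B}$ with $\mu(A)\mu(B)>0$ the set $\{n\in\mathbb{N}:|\mu(A\cap T^{-n}B)-\mu(A)\mu(B)|<\varepsilon\}$ is an $IP^{\star}$-set. For $k\in\mathbb{N}$, a set $C\subseteq\mathbb{N}$ is called a $k$-$MIP^{\star}$-set if there are a mild mixing system $(X,\mathcal{B},\mu,T)$ and $A_0,\dots,A_k\in\mathcal{B}$ with $\mu(A_0)\mu(A_1)\cdots\mu(A_k)>0$ such that $$\Big\{n\in\mathbb{N}:\mu\Big(\bigcap_{i=0}^{k}T^{-in}A_i\Big)>0\Big\}\subseteq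 C.$$ **Theorem.** For every $k\in\mathbb{N}$, the collection $\mathcal{F}$ of all $k$-$MIP^{\star}$-sets is a $ZFSP$ family; that is, $\emptyset\notin\mathcal{F}$ and - (a) every $A\in\mathcal{F}$ is an $IP^{\star}$-set in $(\mathbb{N},+)$; - (b) for every $A\in\mathcal{F}$ there is $C\in\mathcal{F}$ with $C\subseteq A$ such that $-n+C=\{m\in\mathbb{N}:n+m\in C\}\in\mathcal{F}$ for all $n\in C$; - (c) if $A,B\in\mathcal{F}$, then $A\cap B\in\mathcal{F}$; - (d) if $n\in\mathbb{N}$ and $A\in\mathcal{F}$, then $n^{-1}A=\{m\in\mathbb{N}:nm\in A\}\in\mathcal{F}$. -/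

import Mathlib

/-!
By Hindman's theorem a set is an IP*-set if and only if it belongs to every idempotent ultrafilter,
so mild mixing says that `μ (A ∩ T⁻ⁿ B) → μ A * μ B` along every idempotent ultrafilter on `ℕ+`.
Idempotent ultrafilters are preserved by additive maps and the convergence need only be checked on
a generating π-system, so iterates and products of mild mixing systems are mild mixing. A van der
Corput lemma along an idempotent ultrafilter `p` upgrades mixing to mixing of all orders by
induction: with the first of `k + 1` functions split off, the product of the others at time `m`
correlates with the one at time `l + m` as a `k`-fold multicorrelation in `m`, whose limit is
governed by mixing in `l`. Positivity of the limit of `μ (⋂ i, T^{-in} A i)` gives the IP*-property;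
shifts, intersections and dilations of the sets of return times come from moving the `A i`, from
products, and from iterates of the system.
-/

open MeasureTheory

universe u

/-- A set of positive integers is an IP-set if it contains all sums over nonempty finite sets of
indices of some sequence of positive integers (not necessarily with distinct terms). -/
def IsIPSet (A : Set ℕ+) : Prop :=
  ∃ x : Stream' ℕ+, Hindman.FS x ⊆ A

/-- A set of positive integers is an IP*-set if it meets every IP-set. -/
def IsIPStarSet (A : Set ℕ+) : Prop :=
  ∀ B : Set ℕ+, IsIPSet B → (A ∩ B).Nonempty

/-- A family of nonempty sets of positive integers is a zigzag finite sums and products family. -/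
structure IsZFSPFamily (F : Set (Set ℕ+)) : Prop where
  empty_notMem : ∅ ∉ F
  isIPStarSet : ∀ A ∈ F, IsIPStarSet A
  exists_subset_shift : ∀ A ∈ F, ∃ C ∈ F, C ⊆ A ∧ ∀ n ∈ C, {m : ℕ+ | n + m ∈ C} ∈ F
  inter_mem : ∀ A ∈ F, ∀ B ∈ F, A ∩ B ∈ F
  dilate_mem : ∀ n : ℕ+, ∀ A ∈ F, {m : ℕ+ | n * m ∈ A} ∈ F

/-- A mild mixing system: a measure preserving transformation `T` (not necessarily invertible) of a
probability space such that for measurable `A`, `B` of positive measure and `ε > 0` the set of `n`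
with `|μ(A ∩ T⁻ⁿ B) - μ(A) μ(B)| < ε` is an IP*-set. -/
structure IsMildMixing {X : Type*} [MeasurableSpace X] (T : X → X) (μ : Measure X) : Prop where
  isProbabilityMeasure : IsProbabilityMeasure μ
  measurePreserving : MeasurePreserving T μ μ
  isIPStarSet : ∀ ε : ℝ, 0 < ε → ∀ A B : Set X, MeasurableSet A → MeasurableSet B →
    0 < μ A * μ B →
    IsIPStarSet {n : ℕ+ | |μ.real (A ∩ T^[(n : ℕ)] ⁻¹' B) - μ.real A * μ.real B| < ε}

/-- `k`-MIP*-sets: supersets of `{n : μ(⋂ i ≤ k, T^{-in} A i) > 0}` for a mild mixing system and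
measurable sets `A 0, …, A k` of positive measure. -/
def IsMIPStarSet (k : ℕ) (C : Set ℕ+) : Prop :=
  ∃ (X : Type u) (_ : MeasurableSpace X) (T : X → X) (μ : Measure X) (A : Fin (k + 1) → Set X),
    IsMildMixing T μ ∧ (∀ i, MeasurableSet (A i)) ∧ 0 < ∏ i, μ (A i) ∧
      {n : ℕ+ | 0 < μ (⋂ i : Fin (k + 1), T^[(i : ℕ) * (n : ℕ)] ⁻¹' A i)} ⊆ C

open Filter Topology

attribute [local instance] Ultrafilter.add

section IdempotentUltrafilter

theorem ultrafilter_map_add_self {M N : Type*} [Add M] [Add N] {p : Ultrafilter M}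
    (hp : p + p = p) (f : M →ₙ+ N) : p.map f + p.map f = p.map f := by
  refine Ultrafilter.coe_inj.mp (Filter.ext' fun P => ?_)
  nth_rw 3 [← hp]
  simp only [Ultrafilter.eventually_add, Ultrafilter.coe_map, eventually_map, map_add]

theorem eventually_eventually_add_iff {M : Type*} [Add M] {p : Ultrafilter M} (hp : p + p = p)
    {P : M → Prop} : (∀ᶠ m in p, ∀ᶠ n in p, P (m + n)) ↔ ∀ᶠ m in p, P m := by
  rw [← Ultrafilter.eventually_add, hp]

theorem isIPStarSet_iff_forall_mem_ultrafilter {S : Set ℕ+} :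
    IsIPStarSet S ↔ ∀ p : Ultrafilter ℕ+, p + p = p → S ∈ p := by
  refine ⟨fun hS p hp => ?_, fun h B ⟨x, hx⟩ => ?_⟩
  · by_contra hSp
    obtain ⟨a, ha⟩ :=
      Hindman.exists_FS_of_large p hp Sᶜ (Ultrafilter.compl_mem_iff_notMem.mpr hSp)
    obtain ⟨n, hnS, hnSc⟩ := hS Sᶜ ⟨a, ha⟩
    exact hnSc hnS
  · obtain ⟨p, hp, hpx⟩ := Hindman.exists_idempotent_ultrafilter_le_FS x
    exact p.nonempty_of_mem (inter_mem (h p hp) (mem_of_superset hpx hx))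

/-- A list of elements satisfying `Q` in which each entry `a` arises from any earlier entry `b` as
`a = h + b` with `R h b`. In the van der Corput lemma, `R` will express that the vectors indexed by
`b` and `h + b` are nearly orthogonal. -/
def IsDifferenceChain {M : Type*} [Add M] (Q : M → Prop) (R : M → M → Prop) (L : List M) : Prop :=
  (∀ a ∈ L, Q a) ∧ L.Pairwise fun b a => ∃ h, a = h + b ∧ R h b

theorem IsDifferenceChain.cons_map_add_right {M : Type*} [Add M] {Q : M → Prop}
    {R : M → M → Prop} {L : List M} {n : M} (hL : IsDifferenceChain Q R (L.map (· + n)))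
    (hQ : Q n) (hR : ∀ h ∈ L, R h n) : IsDifferenceChain Q R (n :: L.map (· + n)) :=
  ⟨List.forall_mem_cons.2 ⟨hQ, hL.1⟩,
    List.pairwise_cons.2 ⟨List.forall_mem_map.2 fun h hh => ⟨h, rfl, hR h hh⟩, hL.2⟩⟩

theorem exists_isDifferenceChain {M : Type*} [AddSemigroup M] {p : Ultrafilter M} (hp : p + p = p)
    {Q : M → Prop} {R : M → M → Prop} (hQ : ∀ᶠ n in p, Q n)
    (hR : ∀ h, Q h → ∀ᶠ n in p, R h n) (N : ℕ) :
    ∃ L : List M, L.length = N ∧ IsDifferenceChain Q R L ∧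
      ∀ᶠ n in p, IsDifferenceChain Q R (L.map (· + n)) := by
  induction N with
  | zero => exact ⟨[], rfl, by simp [IsDifferenceChain], by simp [IsDifferenceChain]⟩
  | succ N ih =>
    obtain ⟨L, hlen, hL, hLn⟩ := ih
    have hRL : ∀ᶠ n in p, ∀ h ∈ L, R h n :=
      (eventually_all_finite L.finite_toSet).2 fun h hh => hR h (hL.1 h hh)
    have hcons : ∀ᶠ n in p, IsDifferenceChain Q R (n :: L.map (· + n)) := by
      filter_upwards [hLn, hQ, hRL] with n using IsDifferenceChain.cons_map_add_right
    obtain ⟨n, hn, hnm⟩ :=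
      (hcons.and ((eventually_eventually_add_iff hp).2 hcons)).exists
    refine ⟨n :: L.map (· + n), by simp [hlen], hn, hnm.mono fun m hm => ?_⟩
    simpa [Function.comp_def, add_assoc] using hm

end IdempotentUltrafilter

section VanDerCorput

variable {E : Type*} [NormedAddCommGroup E] [InnerProductSpace ℝ E]

theorem inner_list_sum (v : E) (L : List E) : inner ℝ v L.sum = (L.map (inner ℝ v)).sum :=
  map_list_sum (innerSL ℝ v) L

theorem norm_sq_list_sum_le {C δ : ℝ} (hδ : 0 ≤ δ) {L : List E} (hC : ∀ x ∈ L, ‖x‖ ≤ C)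
    (hL : L.Pairwise fun x y => inner ℝ x y ≤ δ) :
    ‖L.sum‖ ^ 2 ≤ L.length * C ^ 2 + (L.length : ℝ) ^ 2 * δ := by
  induction L with
  | nil => simp
  | cons x L ih =>
    rw [List.forall_mem_cons] at hC
    rw [List.pairwise_cons] at hL
    have hx : ‖x‖ ^ 2 ≤ C ^ 2 := pow_le_pow_left₀ (norm_nonneg x) hC.1 2
    have hinner : inner ℝ x L.sum ≤ L.length * δ := by
      rw [inner_list_sum]
      simpa using (L.map (inner ℝ x)).sum_le_card_nsmul δ (List.forall_mem_map.2 hL.1)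
    calc ‖(x :: L).sum‖ ^ 2 = ‖x‖ ^ 2 + 2 * inner ℝ x L.sum + ‖L.sum‖ ^ 2 := by
          rw [List.sum_cons, norm_add_sq_real]
      _ ≤ C ^ 2 + 2 * (L.length * δ) + (L.length * C ^ 2 + (L.length : ℝ) ^ 2 * δ) := by
          gcongr
          exact ih hC.2 hL.2
      _ ≤ (x :: L).length * C ^ 2 + ((x :: L).length : ℝ) ^ 2 * δ := by
          push_cast [List.length_cons]
          linarith

variable {M : Type*} [AddSemigroup M] {p : Ultrafilter M} {u : M → E} {C : ℝ}

theorem eventually_inner_lt_of_eventually_inner_add_le (hp : p + p = p) (hu : ∀ n, ‖u n‖ ≤ C)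
    (h : ∀ δ > 0, ∀ᶠ k in p, ∀ᶠ m in p, inner ℝ (u m) (u (k + m)) ≤ δ) (v : E) {ε : ℝ}
    (hε : 0 < ε) : ∀ᶠ n in p, inner ℝ v (u n) < ε := by
  by_contra hlarge
  simp only [← Ultrafilter.eventually_not, not_lt] at hlarge
  obtain ⟨N, hN⟩ := exists_nat_gt (‖v‖ ^ 2 * (C ^ 2 + 1) / ε ^ 2)
  have hN0 : (0 : ℝ) < N := lt_of_le_of_lt (by positivity) hN
  have hR := h (1 / N) (by positivity)
  obtain ⟨L, hlen, hL, -⟩ := exists_isDifferenceChain hp (hlarge.and hR) (fun _ hk => hk.2) N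
  have hlower : N * ε ≤ inner ℝ v (L.map u).sum := by
    rw [inner_list_sum]
    simpa [hlen] using ((L.map u).map (inner ℝ v)).card_nsmul_le_sum ε
      (by simpa using fun a ha => (hL.1 a ha).1)
  have hupper : ‖(L.map u).sum‖ ^ 2 ≤ N * (C ^ 2 + 1) := by
    have hpair : (L.map u).Pairwise fun x y => inner ℝ x y ≤ 1 / (N : ℝ) := by
      refine List.pairwise_map.2 (hL.2.imp ?_)
      rintro b _ ⟨k, rfl, hk⟩
      exact hk
    have hsum := norm_sq_list_sum_le (by positivity) (List.forall_mem_map.2 fun n _ => hu n) hpair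
    rw [List.length_map, hlen] at hsum
    calc _ ≤ _ := hsum
      _ = N * (C ^ 2 + 1) := by field_simp
  have hsq : (N * ε) ^ 2 ≤ ‖v‖ ^ 2 * (N * (C ^ 2 + 1)) :=
    calc (N * ε) ^ 2 ≤ (‖v‖ * ‖(L.map u).sum‖) ^ 2 := by
          exact pow_le_pow_left₀ (by positivity) (hlower.trans (real_inner_le_norm _ _)) 2
      _ ≤ ‖v‖ ^ 2 * (N * (C ^ 2 + 1)) := by
          rw [mul_pow]
          gcongr
  rw [div_lt_iff₀ (by positivity)] at hN
  nlinarith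

theorem tendsto_inner_zero_of_eventually_inner_add_le (hp : p + p = p) (hu : ∀ n, ‖u n‖ ≤ C)
    (h : ∀ δ > 0, ∀ᶠ k in p, ∀ᶠ m in p, inner ℝ (u m) (u (k + m)) ≤ δ) (v : E) :
    Tendsto (fun n => inner ℝ v (u n)) p (𝓝 0) := by
  refine tendsto_order.2 ⟨fun ε hε => ?_, fun ε hε =>
    eventually_inner_lt_of_eventually_inner_add_le hp hu h v hε⟩
  filter_upwards [eventually_inner_lt_of_eventually_inner_add_le hp hu h (-v) (neg_pos.2 hε)]
    with n hn
  rwa [inner_neg_left, neg_lt_neg_iff] at hn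

theorem tendsto_inner_of_eventually_inner_add_le (hp : p + p = p) (hu : ∀ n, ‖u n‖ ≤ C) {w : E}
    (hw : Tendsto (fun n => inner ℝ w (u n)) p (𝓝 (inner ℝ w w)))
    (h : ∀ δ > 0, ∀ᶠ k in p, ∀ᶠ m in p, inner ℝ (u m) (u (k + m)) ≤ inner ℝ w w + δ) (v : E) :
    Tendsto (fun n => inner ℝ v (u n)) p (𝓝 (inner ℝ v w)) := by
  have hbound : ∀ n, ‖u n - w‖ ≤ C + ‖w‖ := fun n => (norm_sub_le _ _).trans (by grw [hu n])
  have hcorr : ∀ δ > 0, ∀ᶠ k in p, ∀ᶠ m in p, inner ℝ (u m - w) (u (k + m) - w) ≤ δ := by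
    intro δ hδ
    have hw_lower : ∀ᶠ n in p, inner ℝ w w - δ / 3 < inner ℝ w (u n) :=
      hw.eventually_const_lt (by linarith)
    filter_upwards [h (δ / 3) (by positivity), (eventually_eventually_add_iff hp).2 hw_lower]
      with k hk hwk
    filter_upwards [hk, hwk, hw_lower] with m hkm hwkm hwm
    rw [inner_sub_left, inner_sub_right, inner_sub_right, real_inner_comm w (u m)]
    linarith
  have hsub := tendsto_inner_zero_of_eventually_inner_add_le hp hbound hcorr v
  simpa only [inner_sub_right, tendsto_sub_nhds_zero_iff] using hsub

end VanDerCorput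

section Mixing

variable {X Y ι : Type*} [MeasurableSpace X] [MeasurableSpace Y] {μ : Measure X} {ν : Measure Y}
  {l : Filter ι}

/-- Mixing of a family of transformations along a filter: `S n ⁻¹' B` becomes independent of `A` in
the limit. Mild mixing is mixing of the iterates along all idempotent ultrafilters. -/
def IsMixingAlong (μ : Measure X) (S : ι → X → X) (l : Filter ι) : Prop :=
  ∀ ⦃A B : Set X⦄, MeasurableSet A → MeasurableSet B →
    Tendsto (fun n => μ.real (A ∩ S n ⁻¹' B)) l (𝓝 (μ.real A * μ.real B))

theorem isMildMixing_iff {T : X → X} :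
    IsMildMixing T μ ↔ IsProbabilityMeasure μ ∧ MeasurePreserving T μ μ ∧
      ∀ p : Ultrafilter ℕ+, p + p = p → IsMixingAlong μ (fun n : ℕ+ => T^[n]) p := by
  refine ⟨fun h => ⟨h.isProbabilityMeasure, h.measurePreserving, fun p hp A B hA hB => ?_⟩,
    fun ⟨hμ, hT, hmix⟩ => ⟨hμ, hT, fun ε hε A B hA hB _ => ?_⟩⟩
  · have := h.isProbabilityMeasure
    rcases eq_or_ne (μ A) 0 with hA0 | hA0
    · have hnull (n : ℕ+) : μ.real (A ∩ T^[n] ⁻¹' B) = 0 :=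
        measureReal_mono_null Set.inter_subset_left (by simp [measureReal_def, hA0])
      simp [hnull, measureReal_def, hA0]
    rcases eq_or_ne (μ B) 0 with hB0 | hB0
    · have hnull (n : ℕ+) : μ.real (A ∩ T^[n] ⁻¹' B) = 0 := by
        refine measureReal_mono_null Set.inter_subset_right ?_
        rw [(h.measurePreserving.iterate n).measureReal_preimage hB.nullMeasurableSet]
        simp [measureReal_def, hB0]
      simp [hnull, measureReal_def, hB0]
    · exact Metric.tendsto_nhds.2 fun ε hε => isIPStarSet_iff_forall_mem_ultrafilter.1
        (h.isIPStarSet ε hε A B hA hB (pos_of_ne_zero (mul_ne_zero hA0 hB0))) p hp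
  · exact isIPStarSet_iff_forall_mem_ultrafilter.2 fun p hp =>
      Metric.tendsto_nhds.1 (hmix p hp hA hB) ε hε

theorem IsMildMixing.isMixingAlong_iterate_mul {T : X → X} (h : IsMildMixing T μ)
    {p : Ultrafilter ℕ+} (hp : p + p = p) (k : ℕ+) :
    IsMixingAlong μ (fun n : ℕ+ => T^[k * n]) p := by
  intro A B hA hB
  exact tendsto_map'_iff.1 <|
    (isMildMixing_iff.1 h).2.2 _ (ultrafilter_map_add_self hp (AddHom.mulLeft k)) hA hB

theorem IsMildMixing.iterate {T : X → X} (h : IsMildMixing T μ) (k : ℕ+) :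
    IsMildMixing T^[k] μ := by
  refine isMildMixing_iff.2
    ⟨h.isProbabilityMeasure, h.measurePreserving.iterate k, fun p hp => ?_⟩
  simpa only [Function.iterate_mul] using h.isMixingAlong_iterate_mul hp k

theorem hasSum_measureReal_iUnion [IsFiniteMeasure μ] {f : ℕ → Set X}
    (hdisj : Pairwise (Function.onFun Disjoint f)) (hf : ∀ i, MeasurableSet (f i)) :
    HasSum (fun i => μ.real (f i)) (μ.real (⋃ i, f i)) := by
  have hsum := measure_iUnion hdisj hf (μ := μ)
  rw [measureReal_def, hsum, ENNReal.tsum_toReal_eq fun i => measure_ne_top μ (f i)]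
  exact (ENNReal.summable_toReal (hsum ▸ measure_ne_top μ _)).hasSum

theorem tendsto_measureReal_of_isPiSystem {X : Type*} {m : MeasurableSpace X} {μ : Measure X}
    [IsFiniteMeasure μ] {κ : ι → Measure X} (hκ : ∀ n, κ n ≤ μ) {s : Set (Set X)}
    (hs : m = MeasurableSpace.generateFrom s) (hpi : IsPiSystem s) {c : ℝ}
    (huniv : Tendsto (fun n => (κ n).real Set.univ) l (𝓝 (c * μ.real Set.univ)))
    (hgen : ∀ A ∈ s, Tendsto (fun n => (κ n).real A) l (𝓝 (c * μ.real A)))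
    {A : Set X} (hA : MeasurableSet A) :
    Tendsto (fun n => (κ n).real A) l (𝓝 (c * μ.real A)) := by
  have (n : ι) : IsFiniteMeasure (κ n) := isFiniteMeasure_of_le μ (hκ n)
  induction A, hA using MeasurableSpace.induction_on_inter hs hpi with
  | empty => simpa using tendsto_const_nhds
  | basic A hA => exact hgen A hA
  | compl A hA ih =>
    simp only [measureReal_compl hA, mul_sub]
    exact huniv.sub ih
  | iUnion f hdisj hf ih =>
    have hsum := hasSum_measureReal_iUnion (μ := μ) hdisj hf
    simp only [← hsum.tsum_eq, ← (hasSum_measureReal_iUnion hdisj hf).tsum_eq, ← tsum_mul_left]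
    refine tendsto_tsum_of_dominated_convergence hsum.summable ih (.of_forall fun n i => ?_)
    rw [Real.norm_of_nonneg measureReal_nonneg]
    exact ENNReal.toReal_mono (measure_ne_top μ _) (hκ n (f i))

theorem IsMixingAlong.of_isPiSystem {X : Type*} {m : MeasurableSpace X} {μ : Measure X}
    [IsProbabilityMeasure μ] {S : ι → X → X} (hS : ∀ n, MeasurePreserving (S n) μ μ)
    {s : Set (Set X)} (hs : m = MeasurableSpace.generateFrom s) (hpi : IsPiSystem s)
    (hgen : ∀ A ∈ s, ∀ B ∈ s,
      Tendsto (fun n => μ.real (A ∩ S n ⁻¹' B)) l (𝓝 (μ.real A * μ.real B))) :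
    IsMixingAlong μ S l := by
  have hgen_left : ∀ A ∈ s, ∀ B, MeasurableSet B →
      Tendsto (fun n => μ.real (A ∩ S n ⁻¹' B)) l (𝓝 (μ.real A * μ.real B)) := by
    intro A hA B hB
    have hle (n : ι) : (μ.restrict A).map (S n) ≤ μ :=
      (Measure.map_mono Measure.restrict_le_self (hS n).measurable).trans_eq (hS n).map_eq
    have hreal (n : ι) {C : Set X} (hC : MeasurableSet C) :
        ((μ.restrict A).map (S n)).real C = μ.real (A ∩ S n ⁻¹' C) := by
      rw [map_measureReal_apply (hS n).measurable hC,
        measureReal_restrict_apply ((hS n).measurable hC), Set.inter_comm]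
    have hmeas : ∀ C ∈ s, MeasurableSet C := fun C hC =>
      hs ▸ MeasurableSpace.measurableSet_generateFrom hC
    refine (tendsto_measureReal_of_isPiSystem hle hs hpi ?_ (fun C hC => ?_) hB).congr
      fun n => hreal n hB
    · simpa [hreal] using tendsto_const_nhds
    · simpa only [hreal _ (hmeas C hC)] using hgen A hA C hC
  intro A B hA hB
  have hreal (n : ι) {C : Set X} (hC : MeasurableSet C) :
      (μ.restrict (S n ⁻¹' B)).real C = μ.real (C ∩ S n ⁻¹' B) :=
    measureReal_restrict_apply hC
  rw [mul_comm]
  refine (tendsto_measureReal_of_isPiSystem (fun _ => Measure.restrict_le_self) hs hpi ?_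
    (fun C hC => ?_) hA).congr fun n => hreal n hA
  · simpa [(hS _).measureReal_preimage hB.nullMeasurableSet] using tendsto_const_nhds
  · simpa only [mul_comm, hreal _ (hs ▸ MeasurableSpace.measurableSet_generateFrom hC)]
      using hgen_left C hC B hB

theorem IsMixingAlong.prod [IsProbabilityMeasure μ] [IsProbabilityMeasure ν] {S : ι → X → X}
    {R : ι → Y → Y} (hS : IsMixingAlong μ S l) (hR : IsMixingAlong ν R l)
    (hSμ : ∀ n, MeasurePreserving (S n) μ μ) (hRν : ∀ n, MeasurePreserving (R n) ν ν) :
    IsMixingAlong (μ.prod ν) (fun n => Prod.map (S n) (R n)) l := by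
  refine .of_isPiSystem (fun n => (hSμ n).prod (hRν n)) generateFrom_prod.symm isPiSystem_prod ?_
  rintro _ ⟨A, hA, A', hA', rfl⟩ _ ⟨B, hB, B', hB', rfl⟩
  simpa only [Set.preimage_prod_map_prod, Set.prod_inter_prod, measureReal_prod_prod,
    mul_mul_mul_comm] using (hS hA hB).mul (hR hA' hB')

theorem IsMildMixing.prod {T : X → X} {S : Y → Y} (hT : IsMildMixing T μ)
    (hS : IsMildMixing S ν) : IsMildMixing (Prod.map T S) (μ.prod ν) := by
  have := hT.isProbabilityMeasure
  have := hS.isProbabilityMeasure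
  refine isMildMixing_iff.2
    ⟨inferInstance, hT.measurePreserving.prod hS.measurePreserving, fun p hp => ?_⟩
  simpa only [Prod.map_iterate] using
    ((isMildMixing_iff.1 hT).2.2 p hp).prod ((isMildMixing_iff.1 hS).2.2 p hp)
      (fun n => hT.measurePreserving.iterate n) (fun n => hS.measurePreserving.iterate n)

theorem tendsto_apply_of_tendsto_indicatorConstLp {q : ENNReal} [Fact (1 ≤ q)] (hq : q ≠ ⊤)
    {F : Type*} [NormedAddCommGroup F] [NormedSpace ℝ F] {φ : ι → Lp ℝ q μ →L[ℝ] F}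
    {ψ : Lp ℝ q μ →L[ℝ] F} {C : NNReal} (hφ : ∀ n, ‖φ n‖₊ ≤ C)
    (hind : ∀ ⦃s : Set X⦄ (hs : MeasurableSet s) (hμs : μ s ≠ ⊤),
      Tendsto (fun n => φ n (indicatorConstLp q hs hμs 1)) l
        (𝓝 (ψ (indicatorConstLp q hs hμs 1)))) (f : Lp ℝ q μ) :
    Tendsto (fun n => φ n f) l (𝓝 (ψ f)) := by
  induction f using Lp.induction (hp_ne_top := hq) with
  | @indicatorConst c s hs hμs =>
    have hsmul : (Lp.simpleFunc.indicatorConst q hs hμs.ne c : Lp ℝ q μ) =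
        c • indicatorConstLp q hs hμs.ne 1 := by
      rw [Lp.simpleFunc.coe_indicatorConst, indicatorConstLp, indicatorConstLp,
        ← MemLp.toLp_const_smul]
      congr 1
      ext x
      by_cases hx : x ∈ s <;> simp [hx]
    simpa only [hsmul, map_smul] using (hind hs hμs.ne).const_smul c
  | add hf hg _ ihf ihg => simpa only [map_add] using ihf.add ihg
  | isClosed =>
    have hequi : Equicontinuous fun n => ⇑(φ n) :=
      (LipschitzWith.uniformEquicontinuous _ C fun n =>
        (φ n).lipschitz.weaken (hφ n)).equicontinuous
    exact hequi.isClosed_setOfPred_tendsto ψ.continuous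

theorem inner_toLp_toLp {f g : X → ℝ} (hf : MemLp f 2 μ) (hg : MemLp g 2 μ) :
    inner ℝ (hf.toLp f) (hg.toLp g) = ∫ x, f x * g x ∂μ := by
  rw [L2.inner_def]
  refine integral_congr_ae ?_
  filter_upwards [hf.coeFn_toLp, hg.coeFn_toLp] with x hfx hgx
  rw [hfx, hgx, real_inner_eq_re_inner, RCLike.inner_apply]
  simp [mul_comm]

theorem inner_indicatorConstLp_univ [IsFiniteMeasure μ] (f : Lp ℝ 2 μ) :
    inner ℝ (indicatorConstLp 2 .univ (measure_ne_top μ _) (1 : ℝ)) f = ∫ x, f x ∂μ := by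
  rw [L2.inner_indicatorConstLp_one, Measure.restrict_univ]

theorem integral_indicatorConstLp_one [IsFiniteMeasure μ] {A : Set X} (hA : MeasurableSet A)
    (hμA : μ A ≠ ⊤) : ∫ x, indicatorConstLp 2 hA hμA (1 : ℝ) x ∂μ = μ.real A := by
  rw [← inner_indicatorConstLp_univ, L2.real_inner_indicatorConstLp_one_indicatorConstLp_one,
    Set.univ_inter]

theorem IsMixingAlong.tendsto_inner_indicatorConstLp [IsFiniteMeasure μ] {S : ι → X → X}
    (h : IsMixingAlong μ S l) (hS : ∀ n, MeasurePreserving (S n) μ μ) {A : Set X}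
    (hA : MeasurableSet A) (hμA : μ A ≠ ⊤) (g : Lp ℝ 2 μ) :
    Tendsto (fun n => inner ℝ (indicatorConstLp 2 hA hμA 1)
      (Lp.compMeasurePreserving (S n) (hS n) g)) l (𝓝 (μ.real A * ∫ x, g x ∂μ)) := by
  let U (n : ι) : Lp ℝ 2 μ →ₗᵢ[ℝ] Lp ℝ 2 μ := Lp.compMeasurePreservingₗᵢ ℝ (S n) (hS n)
  let one : Lp ℝ 2 μ := indicatorConstLp 2 .univ (measure_ne_top μ _) 1
  rw [← inner_indicatorConstLp_univ]
  refine tendsto_apply_of_tendsto_indicatorConstLp (by simp)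
    (φ := fun n => innerSL ℝ (indicatorConstLp 2 hA hμA 1) ∘L (U n).toContinuousLinearMap)
    (ψ := μ.real A • innerSL ℝ one) (C := ‖indicatorConstLp 2 hA hμA (1 : ℝ)‖₊)
    (fun n => ?_) (fun B hB hμB => ?_) g
  · calc ‖innerSL ℝ (indicatorConstLp 2 hA hμA 1) ∘L (U n).toContinuousLinearMap‖
        ≤ ‖innerSL ℝ (indicatorConstLp 2 hA hμA (1 : ℝ))‖ * ‖(U n).toContinuousLinearMap‖ :=
          ContinuousLinearMap.opNorm_comp_le _ _
      _ ≤ ‖indicatorConstLp 2 hA hμA (1 : ℝ)‖ * 1 := by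
          rw [innerSL_apply_norm]
          gcongr
          exact (U n).norm_toContinuousLinearMap_le
      _ = _ := mul_one _
  · rw [smul_apply, innerSL_apply_apply, smul_eq_mul, inner_indicatorConstLp_univ,
      integral_indicatorConstLp_one]
    exact (h hA hB).congr fun n => (L2.real_inner_indicatorConstLp_one_indicatorConstLp_one hA
      ((hS n).measurable hB)).symm

theorem IsMixingAlong.tendsto_inner_compMeasurePreserving [IsFiniteMeasure μ]
    {S : ι → X → X} (h : IsMixingAlong μ S l) (hS : ∀ n, MeasurePreserving (S n) μ μ)
    (f g : Lp ℝ 2 μ) :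
    Tendsto (fun n => inner ℝ f (Lp.compMeasurePreserving (S n) (hS n) g)) l
      (𝓝 ((∫ x, f x ∂μ) * ∫ x, g x ∂μ)) := by
  let U (n : ι) : Lp ℝ 2 μ →ₗᵢ[ℝ] Lp ℝ 2 μ := Lp.compMeasurePreservingₗᵢ ℝ (S n) (hS n)
  let one : Lp ℝ 2 μ := indicatorConstLp 2 .univ (measure_ne_top μ _) 1
  rw [← inner_indicatorConstLp_univ f, mul_comm]
  refine (tendsto_apply_of_tendsto_indicatorConstLp (by simp) (φ := fun n => innerSL ℝ (U n g))
    (ψ := (∫ x, g x ∂μ) • innerSL ℝ one) (C := ‖g‖₊) (fun n => ?_) (fun A hA hμA => ?_) f).congr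
    fun n => real_inner_comm _ _
  · rw [← NNReal.coe_le_coe, coe_nnnorm, innerSL_apply_norm, (U n).norm_map, coe_nnnorm]
  · rw [smul_apply, innerSL_apply_apply, smul_eq_mul, inner_indicatorConstLp_univ,
      integral_indicatorConstLp_one, mul_comm]
    exact (h.tendsto_inner_indicatorConstLp hS hA hμA g).congr fun n => real_inner_comm _ _

theorem IsMixingAlong.tendsto_integral_mul [IsFiniteMeasure μ] {S : ι → X → X}
    (h : IsMixingAlong μ S l) (hS : ∀ n, MeasurePreserving (S n) μ μ) {f g : X → ℝ}
    (hf : MemLp f 2 μ) (hg : MemLp g 2 μ) :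
    Tendsto (fun n => ∫ x, f x * g (S n x) ∂μ) l (𝓝 ((∫ x, f x ∂μ) * ∫ x, g x ∂μ)) := by
  have key := h.tendsto_inner_compMeasurePreserving hS (hf.toLp f) (hg.toLp g)
  rw [integral_congr_ae hf.coeFn_toLp, integral_congr_ae hg.coeFn_toLp] at key
  refine key.congr fun n => ?_
  rw [Lp.toLp_compMeasurePreserving, inner_toLp_toLp]
  rfl

end Mixing

section MultipleMixing

variable {X : Type*} [MeasurableSpace X] {μ : Measure X} {T : X → X} {k : ℕ}

/-- The correlation of the functions `f 0 ∘ T^0`, `f 1 ∘ T^n`, `f 2 ∘ T^(2 n)`, …, as they occur in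
multiple recurrence. -/
noncomputable def multicorrelation (μ : Measure X) (T : X → X) (f : Fin k → X → ℝ) (n : ℕ) : ℝ :=
  ∫ x, ∏ i, f i (T^[i * n] x) ∂μ

/-- Mixing of order `k` along a filter: the functions in any `k`-fold multicorrelation become
independent in the limit. -/
def IsMultiMixingAlong (μ : Measure X) (T : X → X) (k : ℕ) (l : Filter ℕ+) : Prop :=
  ∀ f : Fin k → X → ℝ, (∀ i, MemLp (f i) ⊤ μ) →
    Tendsto (fun n : ℕ+ => multicorrelation μ T f n) l (𝓝 (∏ i, ∫ x, f i x ∂μ))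

theorem memLp_top_prod_comp {ι : Type*} [Fintype ι] {f : ι → X → ℝ} {S : ι → X → X}
    (hf : ∀ i, MemLp (f i) ⊤ μ) (hS : ∀ i, MeasurePreserving (S i) μ μ) :
    MemLp (fun x => ∏ i, f i (S i x)) ⊤ μ := by
  simpa using MemLp.prod' (s := Finset.univ) (p := fun _ => ⊤) fun i _ =>
    (hf i).comp_measurePreserving (hS i)

theorem norm_toLp_prod_comp_le {ι : Type*} [Fintype ι] [IsProbabilityMeasure μ] {f : ι → X → ℝ}
    {S : ι → X → X} (hf : ∀ i, MemLp (f i) ⊤ μ) (hS : ∀ i, MeasurePreserving (S i) μ μ)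
    {q : ENNReal} (hq : MemLp (fun x => ∏ i, f i (S i x)) q μ) :
    ‖hq.toLp _‖ ≤ ∏ i, lpNorm (f i) ⊤ μ := by
  have hbound (i : ι) : ∀ᵐ x ∂μ, ‖f i (S i x)‖ ≤ lpNorm (f i) ⊤ μ :=
    (hS i).quasiMeasurePreserving.ae (ae_le_lpNorm_exponent_top (hf i))
  have hnonneg : 0 ≤ ∏ i, lpNorm (f i) ⊤ μ := Finset.prod_nonneg fun i _ => lpNorm_nonneg
  suffices ∀ᵐ x ∂μ, ‖hq.toLp _ x‖ ≤ ∏ i, lpNorm (f i) ⊤ μ by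
    simpa [measureUnivNNReal] using Lp.norm_le_of_ae_bound hnonneg this
  filter_upwards [ae_all_iff.2 hbound, hq.coeFn_toLp] with x hx hqx
  rw [hqx, norm_prod]
  exact Finset.prod_le_prod (fun i _ => norm_nonneg _) fun i _ => hx i

theorem integral_prod_iterate_succ_mul (hT : MeasurePreserving T μ μ) {f : Fin k → X → ℝ}
    (hf : ∀ i, MemLp (f i) ⊤ μ) (n : ℕ) :
    ∫ x, ∏ i, f i (T^[(i + 1) * n] x) ∂μ = multicorrelation μ T f n := by
  have hmeas := (memLp_top_prod_comp hf fun i => hT.iterate (i * n)).aestronglyMeasurable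
  have hTn := hT.iterate n
  have hmap := integral_map hTn.aemeasurable (hTn.map_eq ▸ hmeas)
  rw [hTn.map_eq] at hmap
  simp only [multicorrelation, hmap, ← Function.iterate_add_apply, add_one_mul]

theorem integral_prod_mul_prod_eq_multicorrelation (hT : MeasurePreserving T μ μ)
    {f : Fin k → X → ℝ} (hf : ∀ i, MemLp (f i) ⊤ μ) (l m : ℕ) :
    ∫ x, (∏ i, f i (T^[(i + 1) * m] x)) * ∏ i, f i (T^[(i + 1) * (l + m)] x) ∂μ =
      multicorrelation μ T (fun i x => f i x * f i (T^[(i + 1) * l] x)) m := by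
  have hmul (i : Fin k) : MemLp (fun x => f i x * f i (T^[(i + 1) * l] x)) ⊤ μ :=
    ((hf i).comp_measurePreserving (hT.iterate _)).mul (hf i)
  rw [← integral_prod_iterate_succ_mul hT hmul]
  simp only [← Finset.prod_mul_distrib, ← Function.iterate_add_apply, mul_add]

theorem tendsto_prod_integral_mul_iterate [IsFiniteMeasure μ] (hT : MeasurePreserving T μ μ)
    {l : Filter ℕ+} (hmix : ∀ j : ℕ+, IsMixingAlong μ (fun n : ℕ+ => T^[j * n]) l)
    {f : Fin k → X → ℝ} (hf : ∀ i, MemLp (f i) ⊤ μ) :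
    Tendsto (fun n : ℕ+ => ∏ i, ∫ x, f i x * f i (T^[(i + 1) * n] x) ∂μ) l
      (𝓝 ((∏ i, ∫ x, f i x ∂μ) * ∏ i, ∫ x, f i x ∂μ)) := by
  rw [← Finset.prod_mul_distrib]
  exact tendsto_finsetProd _ fun i _ => (hmix (Nat.succPNat i)).tendsto_integral_mul
    (fun _ => hT.iterate _) ((hf i).mono_exponent le_top) ((hf i).mono_exponent le_top)

theorem IsMultiMixingAlong.succ [IsProbabilityMeasure μ] (hT : MeasurePreserving T μ μ)
    {p : Ultrafilter ℕ+} (hp : p + p = p)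
    (hmix : ∀ j : ℕ+, IsMixingAlong μ (fun n : ℕ+ => T^[j * n]) p)
    (hk : IsMultiMixingAlong μ T k p) : IsMultiMixingAlong μ T (k + 1) p := by
  intro f hf
  let g (i : Fin k) : X → ℝ := f i.succ
  have hg (i : Fin k) : MemLp (g i) ⊤ μ := hf i.succ
  let c : ℝ := ∏ i, ∫ x, g i x ∂μ
  have hu (n : ℕ+) : MemLp (fun x => ∏ i, g i (T^[(i + 1) * n] x)) 2 μ :=
    (memLp_top_prod_comp hg fun i => hT.iterate _).mono_exponent le_top
  have hc : MemLp (fun _ : X => c) 2 μ := memLp_const c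
  have hf0 : MemLp (f 0) 2 μ := (hf 0).mono_exponent le_top
  have hcc : inner ℝ (hc.toLp _) (hc.toLp _) = c * c := by
    rw [inner_toLp_toLp, integral_const, probReal_univ, one_smul]
  have hbound (n : ℕ+) : ‖(hu n).toLp _‖ ≤ ∏ i, lpNorm (g i) ⊤ μ :=
    norm_toLp_prod_comp_le hg (fun i => hT.iterate ((i + 1) * n)) (hu n)
  have hweak : Tendsto (fun n => inner ℝ (hc.toLp _) ((hu n).toLp _)) p (𝓝 (c * c)) := by
    simpa only [inner_toLp_toLp, integral_const_mul, integral_prod_iterate_succ_mul hT hg]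
      using (hk g hg).const_mul c
  have hcorr : ∀ δ > 0, ∀ᶠ l in p, ∀ᶠ m in p,
      inner ℝ ((hu m).toLp _) ((hu (l + m)).toLp _) ≤ c * c + δ := by
    intro δ hδ
    filter_upwards [(tendsto_prod_integral_mul_iterate hT hmix hg).eventually_lt_const
      (lt_add_of_pos_right (c * c) hδ)] with l hl
    filter_upwards [(hk _ fun i => ((hg i).comp_measurePreserving
      (hT.iterate ((i + 1) * l))).mul (hg i)).eventually_lt_const hl] with m hm
    rw [inner_toLp_toLp]
    simp only [PNat.add_coe]
    rw [integral_prod_mul_prod_eq_multicorrelation hT hg]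
    exact hm.le
  have key := tendsto_inner_of_eventually_inner_add_le hp hbound (hcc ▸ hweak) (hcc ▸ hcorr)
    (hf0.toLp (f 0))
  simpa only [inner_toLp_toLp, integral_mul_const, multicorrelation, Fin.prod_univ_succ,
    Fin.val_zero, zero_mul, Function.iterate_zero_apply, Fin.val_succ] using key

theorem IsMildMixing.isMultiMixingAlong (h : IsMildMixing T μ) {p : Ultrafilter ℕ+}
    (hp : p + p = p) (k : ℕ) : IsMultiMixingAlong μ T k p := by
  have := h.isProbabilityMeasure
  induction k with
  | zero => exact fun f _ => by simp [multicorrelation]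
  | succ k ih => exact ih.succ h.measurePreserving hp (h.isMixingAlong_iterate_mul hp)

theorem IsMultiMixingAlong.tendsto_measureReal_iInter [IsFiniteMeasure μ]
    (hT : MeasurePreserving T μ μ) {l : Filter ℕ+} (h : IsMultiMixingAlong μ T k l)
    {A : Fin k → Set X} (hA : ∀ i, MeasurableSet (A i)) :
    Tendsto (fun n : ℕ+ => μ.real (⋂ i : Fin k, T^[(i : ℕ) * (n : ℕ)] ⁻¹' A i)) l
      (𝓝 (∏ i, μ.real (A i))) := by
  have key := h (fun i => (A i).indicator 1) fun i =>
    memLp_indicator_const ⊤ (hA i) 1 (.inr (measure_ne_top μ _))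
  simp only [integral_indicator_one (hA _)] at key
  refine key.congr fun n => ?_
  rw [← integral_indicator_one (.iInter fun i => (hT.iterate _).measurable (hA i))]
  refine integral_congr_ae (.of_forall fun x => ?_)
  classical
  simp only [Set.indicator_apply, Set.mem_iInter, Set.mem_preimage, Pi.one_apply,
    Finset.prod_ite_zero, Finset.mem_univ, true_imp_iff, Finset.prod_const_one]

end MultipleMixing

section MIPStar

variable {k : ℕ} {C D : Set ℕ+}

theorem IsMIPStarSet.isIPStarSet (hC : IsMIPStarSet.{u} k C) : IsIPStarSet C := by
  obtain ⟨X, _, T, μ, A, hT, hA, hpos, hAC⟩ := hC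
  have := hT.isProbabilityMeasure
  refine isIPStarSet_iff_forall_mem_ultrafilter.2 fun p hp => ?_
  have hprod_pos : 0 < ∏ i, μ.real (A i) := Finset.prod_pos fun i hi =>
    ENNReal.toReal_pos (Finset.prod_ne_zero_iff.1 hpos.ne' i hi) (measure_ne_top _ _)
  have hlim := (hT.isMultiMixingAlong hp (k + 1)).tendsto_measureReal_iInter
    hT.measurePreserving hA
  filter_upwards [hlim.eventually_const_lt hprod_pos] with n hn
  exact hAC (ENNReal.toReal_pos_iff.1 hn).1

theorem IsMIPStarSet.exists_subset_shift (hC : IsMIPStarSet.{u} k C) :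
    ∃ D, IsMIPStarSet.{u} k D ∧ D ⊆ C ∧ ∀ n, IsMIPStarSet.{u} k {m | n + m ∈ D} := by
  obtain ⟨X, _, T, μ, A, hT, hA, hpos, hAC⟩ := hC
  refine ⟨_, ⟨X, _, T, μ, A, hT, hA, hpos, subset_rfl⟩, hAC, fun n => ?_⟩
  have hTi (i : Fin (k + 1)) := hT.measurePreserving.iterate (i * n)
  refine ⟨X, _, T, μ, fun i => T^[i * n] ⁻¹' A i, hT, fun i => (hTi i).measurable (hA i),
    ?_, fun m hm => ?_⟩
  · simpa only [(hTi _).measure_preimage (hA _).nullMeasurableSet] using hpos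
  · simpa only [Set.mem_ofPred_eq, ← Set.preimage_comp, ← Function.iterate_add, ← mul_add,
      PNat.add_coe] using hm

theorem IsMIPStarSet.inter (hC : IsMIPStarSet.{u} k C) (hD : IsMIPStarSet.{u} k D) :
    IsMIPStarSet.{u} k (C ∩ D) := by
  obtain ⟨X, _, T, μ, A, hT, hA, hApos, hAC⟩ := hC
  obtain ⟨Y, _, S, ν, B, hS, hB, hBpos, hBD⟩ := hD
  have := hT.isProbabilityMeasure
  have := hS.isProbabilityMeasure
  refine ⟨X × Y, _, Prod.map T S, μ.prod ν, fun i => A i ×ˢ B i, hT.prod hS,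
    fun i => (hA i).prod (hB i), ?_, fun n hn => ?_⟩
  · simp only [Measure.prod_prod, Finset.prod_mul_distrib]
    exact ENNReal.mul_pos hApos.ne' hBpos.ne'
  · have hinter : ⋂ i : Fin (k + 1), (Prod.map T S)^[i * n] ⁻¹' A i ×ˢ B i =
        (⋂ i : Fin (k + 1), T^[i * n] ⁻¹' A i) ×ˢ ⋂ i : Fin (k + 1), S^[i * n] ⁻¹' B i := by
      ext x
      simp only [Prod.map_iterate, Set.mem_iInter, Set.mem_preimage, Set.mem_prod, Prod.map_fst,
        Prod.map_snd, forall_and]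
    rw [Set.mem_ofPred_eq, hinter, Measure.prod_prod, CanonicallyOrderedAdd.mul_pos] at hn
    exact ⟨hAC hn.1, hBD hn.2⟩

theorem IsMIPStarSet.dilate (hC : IsMIPStarSet.{u} k C) (n : ℕ+) :
    IsMIPStarSet.{u} k {m | n * m ∈ C} := by
  obtain ⟨X, _, T, μ, A, hT, hA, hpos, hAC⟩ := hC
  refine ⟨X, _, T^[n], μ, A, hT.iterate n, hA, hpos, fun m hm => hAC ?_⟩
  simpa only [Set.mem_ofPred_eq, ← Function.iterate_mul, PNat.mul_coe, mul_left_comm] using hm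

end MIPStar

theorem mainTheorem4 (k : ℕ) (hk : 1 ≤ k) :
    IsZFSPFamily {C : Set ℕ+ | IsMIPStarSet.{u} k C} where
  empty_notMem h := by
    obtain ⟨n, hn, -⟩ := IsMIPStarSet.isIPStarSet h Set.univ ⟨Stream'.const 1, Set.subset_univ _⟩
    exact hn
  isIPStarSet _ hA := IsMIPStarSet.isIPStarSet hA
  exists_subset_shift _ hA := by
    obtain ⟨C, hC, hCA, hshift⟩ := IsMIPStarSet.exists_subset_shift hA
    exact ⟨C, hC, hCA, fun n _ => hshift n⟩
  inter_mem _ hA _ hB := IsMIPStarSet.inter hA hB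
  dilate_mem n _ hA := IsMIPStarSet.dilate hA n
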